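/- Let $H^2$ be the Hardy space of the unit disk $\mathbb{D}$, regarded as the closed subspace of $L^2(\partial\mathbb{D})$ of functions whose Fourier coefficients of negative index vanish, and let $P_+$ be the orthogonal projection of $L^2(\partial\mathbb{D})$ onto $H^2$. Functions in $H^2$ and in $H^\infty=\{\varphi\in L^\infty(\partial\mathbb{D}):\hat\varphi(n)=0\text{ for }n<0\}$ are identified with the holomorphic functions $z\mapsto\sum_{n\ge 0}\hat f(n)z^n$ on $\mathbb{D}$. For $\varphi\in L^\infty(\partial\mathbb{D})$ let $T_\varphi f=P_+(\varphi f)$ be the Toeplitz operator on $H^2$. For $b$ in the closed unit ball of $H^\infty$, let $\mathcal{H}(b)=(1-T_bT_b^*)^{1/2}H^2$ be the de Branges–Rovnyak space. A function $g$ on $\mathbb{D}$ has a nontangential limit at $z_0\in\partial\mathbb{D}$ if there is $L\in\mathbb{C}$ such that, for every $C\ge 1$, $g(z)\to L$ as $z\to z_0$ within the Stolz domain $S_C(z_0)=\{z\in\mathbb{D}:|z-z_0|\le C(1-|z|)\}$. Proposition. Let $z_0\in\partial\mathbb{D}$, let $b$ be nonextreme, that is, an element of the closed unit ball of $H^\infty$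 that is not an extreme point of this ball, and let $n\ge 0$ be an integer. If for every $f\in\mathcal{H}(b)$ and every $k\in\{0,1,\dots,n\}$ the derivative $f^{(k)}$ has a nontangential limit at $z_0$, then $b^{(n+1)}$ also has a nontangential limit at $z_0$. -/

import Mathlib

open MeasureTheory Filter Topology
open scoped ENNReal

noncomputable section

/-- Normalized arc length on the unit circle, whose points are written `exp (2 π i t)` with
`t ∈ ℝ / ℤ`. -/
abbrev circleMeasure : Measure UnitAddCircle := AddCircle.haarAddCircle

/-- The Hardy space `H²`: the closed subspace of `L²` of the unit circle that consists of the
functions whose Fourier coefficients of negative index vanish. -/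
def H2 : Submodule ℂ (Lp ℂ 2 circleMeasure) where
  carrier := {f | ∀ n : ℤ, n < 0 → fourierCoeff f n = 0}
  zero_mem' := by
    intro n _
    rw [← fourierBasis_repr, map_zero]
    rfl
  add_mem' := by
    intro f g hf hg n hn
    rw [← fourierBasis_repr, map_add, lp.coeFn_add, Pi.add_apply, fourierBasis_repr,
      fourierBasis_repr, hf n hn, hg n hn, add_zero]
  smul_mem' := by
    intro c f hf n hn
    rw [← fourierBasis_repr, map_smul, lp.coeFn_smul, Pi.smul_apply, fourierBasis_repr,
      hf n hn, smul_zero]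

theorem isClosed_H2 : IsClosed (H2 : Set (Lp ℂ 2 circleMeasure)) := by
  have h : (H2 : Set (Lp ℂ 2 circleMeasure)) =
      ⋂ (n : ℤ) (_ : n < 0), {f | (inner ℂ (fourierBasis (T := 1) n) f : ℂ) = 0} := by
    ext f
    simp only [Set.mem_iInter, Set.mem_ofPred_eq]
    refine forall₂_congr fun n _ => ?_
    rw [← HilbertBasis.repr_apply_apply, fourierBasis_repr]
  rw [h]
  refine isClosed_iInter fun n => isClosed_iInter fun _ => isClosed_eq ?_ continuous_const
  fun_prop

instance completeSpace_H2 : CompleteSpace H2 := isClosed_H2.completeSpace_coe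

/-- The closed unit ball of `H^∞`, where `H^∞` consists of the functions in `L^∞` of the unit
circle (the boundary functions) whose Fourier coefficients of negative index vanish. -/
def unitBallHInf : Set (Lp ℂ ∞ circleMeasure) :=
  {b | (∀ n : ℤ, n < 0 → fourierCoeff b n = 0) ∧ ‖b‖ ≤ 1}

/-- A nonextreme function: an element of the closed unit ball of `H^∞` that is not an extreme
point of this ball. -/
def IsNonextreme (b : Lp ℂ ∞ circleMeasure) : Prop :=
  b ∈ unitBallHInf ∧ b ∉ Set.extremePoints ℝ unitBallHInf

/-- The function on the unit disk `z ↦ ∑ n ≥ 0, f̂(n) z ^ n` that is determined by a function `f`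
on the unit circle; for `f` in `H²` or `H^∞` this is the holomorphic function on the disk with
boundary function `f`. Only its values for `|z| < 1` matter. -/
def diskFun (f : UnitAddCircle → ℂ) (z : ℂ) : ℂ :=
  ∑' n : ℕ, fourierCoeff f (n : ℤ) * z ^ n

/-- The Toeplitz operator `T_φ f = P₊ (φ f)` on `H²`, for `φ` in `L^∞` of the unit circle, where
`P₊` is the orthogonal projection of `L²` onto `H²`. -/
def toeplitz (φ : Lp ℂ ∞ circleMeasure) : H2 →L[ℂ] H2 :=
  H2.orthogonalProjectionOnto ∘L
    (ContinuousLinearMap.mul ℂ ℂ).holderL circleMeasure ∞ 2 2 φ ∘L H2.subtypeL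

/-- The positive square root `A^{1/2}` of a positive bounded operator `A` on a Hilbert space. -/
def operatorSqrt {H : Type*} [NormedAddCommGroup H] [InnerProductSpace ℂ H] [CompleteSpace H]
    (A : H →L[ℂ] H) : H →L[ℂ] H :=
  CFC.sqrt A

/-- The de Branges-Rovnyak space `H(b)`, as a space of elements of `H²`: the image of `H²` under
the operator `(1 - T_b T_b^*)^{1/2}`. -/
def deBrangesRovnyak (b : Lp ℂ ∞ circleMeasure) : Submodule ℂ H2 :=
  LinearMap.range
    (operatorSqrt (1 - toeplitz b ∘L ContinuousLinearMap.adjoint (toeplitz b))).toLinearMap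

/-- The Stolz domain `S_C(z₀)` in the unit disk. -/
def stolzDomain (C : ℝ) (z₀ : ℂ) : Set ℂ :=
  {z | ‖z‖ < 1 ∧ ‖z - z₀‖ ≤ C * (1 - ‖z‖)}

/-- The function `g` on the unit disk has a (finite) nontangential limit at the point `z₀` of the
unit circle. -/
def HasNontangentialLimit (g : ℂ → ℂ) (z₀ : ℂ) : Prop :=
  ∃ L : ℂ, ∀ C : ℝ, 1 ≤ C → Tendsto g (𝓝[stolzDomain C z₀] z₀) (𝓝 L)

end

/-! Evaluation at `w` on `H(b)` is given by the kernel `(1 - b(z) conj b(w)) / (1 - z conj w)`. If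
all values converge along points tending to `z₀`, Banach-Steinhaus bounds the kernels and gives a
weak limit, so `H(b)` contains `f = (1 - b conj lam) / (1 - z conj z₀)` with `|lam| = 1`
(`exists_boundary_kernel`). Solving for `b` gives `b = lam + lam conj z₀ (z - z₀) f`, hence `b^(n+1)
= lam conj z₀ ((z - z₀) f^(n+1) + (n+1) f^(n))`. The last term converges by assumption; the other
tends to `0` by a Cauchy estimate (`tendsto_sub_mul_deriv_stolzDomain`). -/

theorem one_sub_mul_conj_ne_zero {z z₀ : ℂ} (hz : ‖z‖ < 1) (hz₀ : ‖z₀‖ = 1) :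
    1 - z * starRingEnd ℂ z₀ ≠ 0 := by
  intro h
  have h₁ : ‖z * starRingEnd ℂ z₀‖ = 1 := by rw [← sub_eq_zero.mp h, norm_one]
  rw [norm_mul, RCLike.norm_conj, hz₀, mul_one] at h₁
  exact hz.ne h₁

/-- The Szegő kernel `z ↦ 1 / (1 - w̄ z)` in a Hilbert space with the orthonormal sequence `e` in
place of the monomials. -/
noncomputable def szegoKernel {H : Type*} [NormedAddCommGroup H] [InnerProductSpace ℂ H]
    (e : ℕ → H) (w : ℂ) : H :=
  ∑' n : ℕ, (starRingEnd ℂ w) ^ n • e n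

/-! ### Kernels and weak limits in an abstract Hilbert space -/

section HilbertSpace

variable {H : Type*} [NormedAddCommGroup H] [InnerProductSpace ℂ H] [CompleteSpace H]
  {e : ℕ → H}

theorem hasSum_szegoKernel (he : Orthonormal ℂ e) {w : ℂ} (hw : ‖w‖ < 1) :
    HasSum (fun n : ℕ => (starRingEnd ℂ w) ^ n • e n) (szegoKernel e w) := by
  refine Summable.hasSum (Summable.of_norm ?_)
  simpa [norm_smul, he.1] using summable_geometric_of_lt_one (norm_nonneg w) hw

theorem hasSum_inner_szegoKernel (he : Orthonormal ℂ e) {w : ℂ} (hw : ‖w‖ < 1) (f : H) :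
    HasSum (fun n : ℕ => (inner ℂ (e n) f : ℂ) * w ^ n) (inner ℂ (szegoKernel e w) f) := by
  have h := ((innerSL ℂ f).hasSum (hasSum_szegoKernel he hw)).star
  simp only [innerSL_apply_apply, RCLike.star_def, inner_conj_symm, inner_smul_left, map_pow,
    Complex.conj_conj] at h
  simpa only [mul_comm] using h

theorem inner_szegoKernel_apply (he : Orthonormal ℂ e) {w : ℂ} (hw : ‖w‖ < 1) (n : ℕ) :
    (inner ℂ (szegoKernel e w) (e n) : ℂ) = w ^ n := by
  rw [← (hasSum_inner_szegoKernel he hw (e n)).tsum_eq, tsum_eq_single n]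
  · simp [he.1]
  · intro m hm
    rw [he.2 hm, zero_mul]

theorem inner_szegoKernel_szegoKernel (he : Orthonormal ℂ e) {z w : ℂ} (hz : ‖z‖ < 1)
    (hw : ‖w‖ < 1) :
    (inner ℂ (szegoKernel e z) (szegoKernel e w) : ℂ) = (1 - z * starRingEnd ℂ w)⁻¹ := by
  have h := (innerSL ℂ (szegoKernel e z)).hasSum (hasSum_szegoKernel he hw)
  simp only [innerSL_apply_apply, inner_smul_right, inner_szegoKernel_apply he hz,
    ← mul_pow] at h
  rw [mul_comm z]
  refine h.unique (hasSum_geometric_of_norm_lt_one ?_)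
  rw [norm_mul, RCLike.norm_conj]
  exact mul_lt_one_of_nonneg_of_lt_one_left (norm_nonneg _) hw hz.le

/-- Both sides have the same inner product with every `e m`, and `hext` says that these determine a
vector. -/
theorem adjoint_szegoKernel (he : Orthonormal ℂ e)
    (hext : ∀ f : H, (∀ n, (inner ℂ (e n) f : ℂ) = 0) → f = 0) {T : H →L[ℂ] H} {w β : ℂ}
    (hw : ‖w‖ < 1) (hT : ∀ m, (inner ℂ (szegoKernel e w) (T (e m)) : ℂ) = w ^ m * β) :
    ContinuousLinearMap.adjoint T (szegoKernel e w) = starRingEnd ℂ β • szegoKernel e w := by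
  refine sub_eq_zero.mp (hext _ fun m => ?_)
  rw [inner_sub_right, ContinuousLinearMap.adjoint_inner_right, inner_smul_right,
    ← inner_conj_symm, hT, map_mul, ← inner_conj_symm (e m), inner_szegoKernel_apply he hw,
    mul_comm, sub_self]

theorem one_sub_comp_adjoint_nonneg {T : H →L[ℂ] H} (hT : ‖T‖ ≤ 1) :
    0 ≤ 1 - T ∘L ContinuousLinearMap.adjoint T := by
  rw [ContinuousLinearMap.nonneg_iff_isPositive, ContinuousLinearMap.isPositive_def]
  constructor
  · exact ((IsSelfAdjoint.one _).sub (IsSelfAdjoint.mul_star_self T)).isSymmetric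
  · intro x
    have h : ‖ContinuousLinearMap.adjoint T x‖ ≤ ‖x‖ := by
      refine ((ContinuousLinearMap.adjoint T).le_of_opNorm_le (c := 1) ?_ x).trans (by simp)
      rw [LinearIsometryEquiv.norm_map]
      exact hT
    have h₁ : (1 - T ∘L ContinuousLinearMap.adjoint T) x =
      x - T (ContinuousLinearMap.adjoint T x) := rfl
    rw [ContinuousLinearMap.reApplyInnerSelf_apply, h₁, inner_sub_left, map_sub,
      ← ContinuousLinearMap.adjoint_inner_right,
      inner_self_eq_norm_sq, inner_self_eq_norm_sq, sub_nonneg]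
    gcongr

theorem inner_operatorSqrt_left (B : H →L[ℂ] H) (x y : H) :
    (inner ℂ (operatorSqrt B x) y : ℂ) = inner ℂ x (operatorSqrt B y) :=
  (IsSelfAdjoint.of_nonneg (CFC.sqrt_nonneg B)).isSymmetric x y

/-- The root is self-adjoint with square `1 - T T*`, and the Szegő kernels are eigenvectors of `T*`.
-/
theorem inner_operatorSqrt_szegoKernel (he : Orthonormal ℂ e) {T : H →L[ℂ] H} (hT : ‖T‖ ≤ 1)
    {β : ℂ → ℂ} (hadj : ∀ w : ℂ, ‖w‖ < 1 → ContinuousLinearMap.adjoint T (szegoKernel e w) =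
      starRingEnd ℂ (β w) • szegoKernel e w) {z w : ℂ} (hz : ‖z‖ < 1) (hw : ‖w‖ < 1) :
    (inner ℂ (operatorSqrt (1 - T ∘L ContinuousLinearMap.adjoint T) (szegoKernel e z))
      (operatorSqrt (1 - T ∘L ContinuousLinearMap.adjoint T) (szegoKernel e w)) : ℂ) =
      (1 - β z * starRingEnd ℂ (β w)) / (1 - z * starRingEnd ℂ w) := by
  have h : operatorSqrt (1 - T ∘L ContinuousLinearMap.adjoint T)
      (operatorSqrt (1 - T ∘L ContinuousLinearMap.adjoint T) (szegoKernel e w)) =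
      szegoKernel e w - T (ContinuousLinearMap.adjoint T (szegoKernel e w)) :=
    congrArg (fun S : H →L[ℂ] H => S (szegoKernel e w))
      (CFC.sqrt_mul_sqrt_self _ (one_sub_comp_adjoint_nonneg hT))
  rw [inner_operatorSqrt_left, h, inner_sub_right, ← ContinuousLinearMap.adjoint_inner_left,
    hadj z hz, hadj w hw, inner_smul_left, inner_smul_right,
    inner_szegoKernel_szegoKernel he hz hw, Complex.conj_conj]
  ring

/-- A sequence of vectors that is pointwise convergent as a sequence of functionals is bounded and
has a weak limit. -/
theorem exists_weak_limit {u : ℕ → H}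
    (h : ∀ f : H, ∃ L : ℂ, Tendsto (fun m => (inner ℂ (u m) f : ℂ)) atTop (𝓝 L)) :
    ∃ v : H, ∃ M : ℝ, (∀ m, ‖u m‖ ≤ M) ∧
      ∀ f : H, Tendsto (fun m => (inner ℂ f (u m) : ℂ)) atTop (𝓝 (inner ℂ f v)) := by
  obtain ⟨M, hM⟩ := banach_steinhaus (g := fun m => innerSL ℂ (u m)) fun f => by
    obtain ⟨L, hL⟩ := h f
    obtain ⟨M, hM⟩ := hL.norm.bddAbove_range
    exact ⟨M, fun m => hM ⟨m, rfl⟩⟩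
  choose ev hev using h
  let E : H →L[ℂ] ℂ := continuousLinearMapOfTendsto (fun m => innerSL ℂ (u m))
    (tendsto_pi_nhds.mpr hev)
  refine ⟨(InnerProductSpace.toDual ℂ H).symm E, M, fun m => ?_, fun f => ?_⟩
  · rw [← innerSL_apply_norm (𝕜 := ℂ)]
    exact hM m
  · have h₁ : (inner ℂ ((InnerProductSpace.toDual ℂ H).symm E) f : ℂ) = ev f :=
      InnerProductSpace.toDual_symm_apply
    have h₂ := (Complex.continuous_conj.tendsto _).comp (hev f)
    rw [← h₁, inner_conj_symm] at h₂
    exact h₂.congr fun m => inner_conj_symm f (u m)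

/-- If `w m` are points of the disk that converge to `z₀` such that the kernels `u m` of a
de Branges-Rovnyak space at `w m` converge weakly, then they converge to a boundary kernel. -/
theorem exists_boundary_kernel_of_inner {β : ℂ → ℂ} {k : ℂ → H}
    (hk : ∀ z w : ℂ, ‖z‖ < 1 → ‖w‖ < 1 → (inner ℂ (k z) (k w) : ℂ) =
      (1 - β z * starRingEnd ℂ (β w)) / (1 - z * starRingEnd ℂ w))
    {z₀ : ℂ} (hz₀ : ‖z₀‖ = 1) {w : ℕ → ℂ} (hw : ∀ m, ‖w m‖ < 1) (hwz : Tendsto w atTop (𝓝 z₀))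
    (h : ∀ f : H, ∃ L : ℂ, Tendsto (fun m => (inner ℂ (k (w m)) f : ℂ)) atTop (𝓝 L)) :
    ∃ v : H, ∃ lam : ℂ, ‖lam‖ = 1 ∧ ∀ z : ℂ, ‖z‖ < 1 →
      (inner ℂ (k z) v : ℂ) = (1 - β z * starRingEnd ℂ lam) / (1 - z * starRingEnd ℂ z₀) := by
  obtain ⟨v, M, hM, hv⟩ := exists_weak_limit h
  have hpos : ∀ m, (0 : ℝ) < 1 - ‖w m‖ ^ 2 := fun m => by nlinarith [hw m, norm_nonneg (w m)]
  have hnorm : ∀ m, ‖k (w m)‖ ^ 2 * (1 - ‖w m‖ ^ 2) = 1 - ‖β (w m)‖ ^ 2 := by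
    intro m
    have h₁ := hk (w m) (w m) (hw m) (hw m)
    simp only [Complex.mul_conj, Complex.normSq_eq_norm_sq] at h₁
    have h₃ : ((‖k (w m)‖ ^ 2 : ℝ) : ℂ) = ((1 - ‖β (w m)‖ ^ 2) / (1 - ‖w m‖ ^ 2) : ℝ) := by
      rw [inner_self_eq_norm_sq_to_K] at h₁
      push_cast at h₁ ⊢
      exact h₁
    rw [Complex.ofReal_inj] at h₃
    rw [h₃, div_mul_cancel₀ _ (hpos m).ne']
  have hle : ∀ m, ‖β (w m)‖ ≤ 1 := by
    intro m
    have := mul_nonneg (sq_nonneg ‖k (w m)‖) (hpos m).le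
    rw [hnorm m] at this
    nlinarith [norm_nonneg (β (w m))]
  -- Bounded kernel norms force `|β (w m)| → 1`, since `1 - |w m|² → 0`.
  have hone : Tendsto (fun m => 1 - ‖β (w m)‖ ^ 2) atTop (𝓝 0) := by
    have h₁ : Tendsto (fun m => M ^ 2 * (1 - ‖w m‖ ^ 2)) atTop (𝓝 0) := by
      have h₂ := ((hwz.norm.pow 2).const_sub 1).const_mul (M ^ 2)
      simpa [hz₀] using h₂
    refine squeeze_zero (fun m => ?_) (fun m => ?_) h₁
    · have := hle m
      nlinarith [norm_nonneg (β (w m))]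
    · rw [← hnorm m]
      have h₂ := (hpos m).le
      have h₃ := hM m
      gcongr
  -- Convergence of `β (w m)` is not known, but a subsequence suffices: `v` is the weak limit along
  -- it too.
  obtain ⟨lam, -, φ, hφ, hlam⟩ :=
    (isCompact_closedBall (0 : ℂ) 1).tendsto_subseq (x := fun m => β (w m))
      fun m => by simpa using hle m
  have hlam1 : ‖lam‖ = 1 := by
    have h₁ := tendsto_nhds_unique ((hlam.norm.pow 2).const_sub 1) (hone.comp hφ.tendsto_atTop)
    nlinarith [norm_nonneg lam]
  refine ⟨v, lam, hlam1, fun z hz => ?_⟩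
  refine tendsto_nhds_unique ((hv (k z)).comp hφ.tendsto_atTop) ?_
  have hne : 1 - z * starRingEnd ℂ z₀ ≠ 0 := one_sub_mul_conj_ne_zero hz hz₀
  have hnum := (((Complex.continuous_conj.tendsto _).comp hlam).const_mul (β z)).const_sub 1
  have hden := (((Complex.continuous_conj.tendsto _).comp
    (hwz.comp hφ.tendsto_atTop)).const_mul z).const_sub 1
  exact (hnum.div hden hne).congr fun m => (hk z _ hz (hw (φ m))).symm

end HilbertSpace

/-! ### The Hardy space and the kernels of `H(b)` -/

/-- The monomial `z ↦ z ^ n`, as an element of `H²`. -/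
noncomputable def monomialH2 (n : ℕ) : H2 :=
  ⟨fourierBasis (T := 1) (n : ℤ), fun m hm => by
    rw [← fourierBasis_repr, HilbertBasis.repr_self, lp.single_apply_ne _ _ _ (by omega)]⟩

theorem inner_monomialH2 (n : ℕ) (f : H2) :
    (inner ℂ (monomialH2 n) f : ℂ) = fourierCoeff (f : UnitAddCircle → ℂ) n := by
  rw [Submodule.coe_inner, ← fourierBasis_repr, HilbertBasis.repr_apply_apply]
  rfl

theorem orthonormal_monomialH2 : Orthonormal ℂ monomialH2 :=
  ⟨fun n => (fourierBasis (T := 1)).orthonormal.1 (n : ℤ), fun m n hmn =>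
    (fourierBasis (T := 1)).orthonormal.2 (i := (m : ℤ)) (j := (n : ℤ)) (by exact_mod_cast hmn)⟩

theorem eq_zero_of_inner_monomialH2 {f : H2} (h : ∀ n, (inner ℂ (monomialH2 n) f : ℂ) = 0) :
    f = 0 := by
  apply Subtype.ext
  apply (fourierBasis (T := 1)).repr.injective
  rw [ZeroMemClass.coe_zero, map_zero]
  ext n
  rw [fourierBasis_repr]
  rcases lt_or_ge n 0 with hn | hn
  · exact f.2 n hn
  · lift n to ℕ using hn
    rw [← inner_monomialH2, h]
    rfl

theorem inner_szegoKernel_monomialH2 {w : ℂ} (hw : ‖w‖ < 1) (f : H2) :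
    (inner ℂ (szegoKernel monomialH2 w) f : ℂ) = diskFun f w := by
  rw [← (hasSum_inner_szegoKernel orthonormal_monomialH2 hw f).tsum_eq, diskFun]
  simp only [inner_monomialH2]

theorem differentiableOn_diskFun {f : UnitAddCircle → ℂ} {M : ℝ}
    (hf : ∀ n : ℕ, ‖fourierCoeff f n‖ ≤ M) :
    DifferentiableOn ℂ (diskFun f) (Metric.ball 0 1) := by
  intro z hz
  rw [mem_ball_zero_iff] at hz
  obtain ⟨r, hzr, hr⟩ := exists_between hz
  have hr0 : 0 ≤ r := (norm_nonneg z).trans hzr.le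
  have h : DifferentiableOn ℂ (diskFun f) (Metric.ball 0 r) := by
    refine Complex.differentiableOn_tsum_of_summable_norm
      ((summable_geometric_of_lt_one hr0 hr).mul_left M)
      (fun n => by fun_prop) Metric.isOpen_ball (fun n w hw => ?_)
    rw [mem_ball_zero_iff] at hw
    rw [norm_mul, norm_pow]
    have := (norm_nonneg _).trans (hf 0)
    gcongr
    exact hf n
  exact (h.differentiableAt (Metric.isOpen_ball.mem_nhds (by simpa using hzr))).differentiableWithinAt

theorem differentiableOn_diskFun_H2 (f : H2) :
    DifferentiableOn ℂ (diskFun f) (Metric.ball 0 1) := by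
  refine differentiableOn_diskFun (M := ‖f‖) fun n => ?_
  rw [← inner_monomialH2]
  refine (norm_inner_le_norm (𝕜 := ℂ) (monomialH2 n) f).trans_eq ?_
  rw [orthonormal_monomialH2.1 n, one_mul]

theorem norm_toeplitz_le (b : Lp ℂ ∞ circleMeasure) : ‖toeplitz b‖ ≤ ‖b‖ := by
  refine ContinuousLinearMap.opNorm_le_bound _ (norm_nonneg _) fun f => ?_
  refine (H2.norm_orthogonalProjectionOnto_apply_le _).trans ?_
  refine ((ContinuousLinearMap.mul ℂ ℂ).norm_holder_apply_apply_le b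
    (f : Lp ℂ 2 circleMeasure)).trans ?_
  simp

/-- The projection drops out against an element of `H²`, and multiplying by a monomial shifts
Fourier indices. -/
theorem inner_monomialH2_toeplitz (b : Lp ℂ ∞ circleMeasure) (m n : ℕ) :
    (inner ℂ (monomialH2 n) (toeplitz b (monomialH2 m)) : ℂ) = fourierCoeff b ((n : ℤ) - m) := by
  have h : (inner ℂ (monomialH2 n) (toeplitz b (monomialH2 m)) : ℂ) =
      inner ℂ (fourierBasis (T := 1) (n : ℤ))
        ((ContinuousLinearMap.mul ℂ ℂ).holder 2 b (fourierBasis (T := 1) (m : ℤ))) :=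
    H2.inner_orthogonalProjectionOnto_eq_of_mem_left (monomialH2 n) _
  rw [h, ← HilbertBasis.repr_apply_apply, fourierBasis_repr]
  refine integral_congr_ae ?_
  filter_upwards [(ContinuousLinearMap.mul ℂ ℂ).coeFn_holder (r := 2) b
    (fourierBasis (T := 1) (m : ℤ)), coeFn_fourierLp (T := 1) 2 (m : ℤ)] with t h₁ h₂
  rw [h₁, coe_fourierBasis, ContinuousLinearMap.mul_apply', h₂, neg_sub, sub_eq_add_neg,
    add_comm, fourier_add, smul_eq_mul, smul_eq_mul]
  ring

theorem diskFun_toeplitz_monomialH2 {b : Lp ℂ ∞ circleMeasure} (hb : b ∈ unitBallHInf) (m : ℕ)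
    {w : ℂ} (hw : ‖w‖ < 1) :
    diskFun (toeplitz b (monomialH2 m)) w = w ^ m * diskFun b w := by
  simp only [diskFun, ← inner_monomialH2, inner_monomialH2_toeplitz]
  have hs : Summable fun n : ℕ => fourierCoeff b ((n : ℤ) - m) * w ^ n := by
    have h := (hasSum_inner_szegoKernel orthonormal_monomialH2 hw (toeplitz b (monomialH2 m))).summable
    simpa only [inner_monomialH2_toeplitz] using h
  rw [← hs.sum_add_tsum_nat_add m, Finset.sum_eq_zero, zero_add, ← tsum_mul_left]
  · refine tsum_congr fun n => ?_
    rw [Nat.cast_add, add_sub_cancel_right, pow_add]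
    ring
  · intro i hi
    rw [Finset.mem_range] at hi
    rw [hb.1 _ (by omega), zero_mul]

theorem adjoint_toeplitz_szegoKernel {b : Lp ℂ ∞ circleMeasure} (hb : b ∈ unitBallHInf)
    {w : ℂ} (hw : ‖w‖ < 1) :
    ContinuousLinearMap.adjoint (toeplitz b) (szegoKernel monomialH2 w) =
      starRingEnd ℂ (diskFun b w) • szegoKernel monomialH2 w :=
  adjoint_szegoKernel orthonormal_monomialH2 (fun _ => eq_zero_of_inner_monomialH2) hw fun m => by
    rw [inner_szegoKernel_monomialH2 hw, diskFun_toeplitz_monomialH2 hb m hw]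

/-- Moves evaluation on the range of the root back to `H²`, so weak limits can be taken there
without a norm on `H(b)`. -/
theorem diskFun_operatorSqrt (B : H2 →L[ℂ] H2) (f : H2) {z : ℂ} (hz : ‖z‖ < 1) :
    diskFun (operatorSqrt B f) z =
      inner ℂ (operatorSqrt B (szegoKernel monomialH2 z)) f := by
  rw [← inner_szegoKernel_monomialH2 hz]
  exact (inner_operatorSqrt_left B _ f).symm

/-- If `z₀` is the limit of points `w m` of the disk at which the values of every function in
`H(b)` converge, then the boundary kernel at `z₀` belongs to `H(b)`. -/
theorem exists_boundary_kernel {b : Lp ℂ ∞ circleMeasure} (hb : b ∈ unitBallHInf)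
    {z₀ : ℂ} (hz₀ : ‖z₀‖ = 1) {w : ℕ → ℂ} (hw : ∀ m, ‖w m‖ < 1) (hwz : Tendsto w atTop (𝓝 z₀))
    (h : ∀ f ∈ deBrangesRovnyak b, ∃ L, Tendsto (fun m => diskFun f (w m)) atTop (𝓝 L)) :
    ∃ f ∈ deBrangesRovnyak b, ∃ lam : ℂ, ‖lam‖ = 1 ∧ ∀ z : ℂ, ‖z‖ < 1 →
      diskFun f z = (1 - diskFun b z * starRingEnd ℂ lam) / (1 - z * starRingEnd ℂ z₀) := by
  obtain ⟨v, lam, hlam, hv⟩ := exists_boundary_kernel_of_inner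
    (k := fun z => operatorSqrt (1 - toeplitz b ∘L ContinuousLinearMap.adjoint (toeplitz b))
      (szegoKernel monomialH2 z))
    (fun z w hz hw => inner_operatorSqrt_szegoKernel orthonormal_monomialH2
      ((norm_toeplitz_le b).trans hb.2) (fun w hw => adjoint_toeplitz_szegoKernel hb hw) hz hw)
    hz₀ hw hwz fun f => by
      obtain ⟨L, hL⟩ := h _ ⟨f, rfl⟩
      exact ⟨L, hL.congr fun m => diskFun_operatorSqrt _ f (hw m)⟩
  refine ⟨_, ⟨v, rfl⟩, lam, hlam, fun z hz => ?_⟩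
  rw [← hv z hz]
  exact diskFun_operatorSqrt _ v hz

/-! ### Derivatives near the boundary point -/

/-- The derivative of a function with a nontangential limit grows slower than the reciprocal of
the distance to the boundary point in every Stolz domain. -/
theorem tendsto_sub_mul_deriv_stolzDomain {G : ℂ → ℂ} (hG : DifferentiableOn ℂ G (Metric.ball 0 1))
    {z₀ L : ℂ} (hz₀ : ‖z₀‖ = 1)
    (h : ∀ C : ℝ, 1 ≤ C → Tendsto G (𝓝[stolzDomain C z₀] z₀) (𝓝 L)) {C : ℝ} (hC : 1 ≤ C) :
    Tendsto (fun z => (z - z₀) * deriv G z) (𝓝[stolzDomain C z₀] z₀) (𝓝 0) := by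
  rw [Metric.tendsto_nhdsWithin_nhds]
  intro ε hε
  have hε' : 0 < ε / (4 * C) := by positivity
  -- For `z` in `S_C`, the disc about `z` of radius `(1 - |z|)/2` lies in `S_{2C+1}`: there `|ζ -
  -- z₀| ≤ (C + 1/2)(1 - |z|)` and `1 - |ζ| ≥ (1 - |z|)/2`.
  obtain ⟨δ, hδ, hδG⟩ := Metric.tendsto_nhdsWithin_nhds.mp (h (2 * C + 1) (by linarith)) _ hε'
  refine ⟨δ / 2, by positivity, fun z hz hzδ => ?_⟩
  obtain ⟨hz1, hzC⟩ := hz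
  rw [dist_eq_norm] at hzδ
  have hd : 0 < 1 - ‖z‖ := by linarith
  have hdz : 1 - ‖z‖ ≤ ‖z - z₀‖ := by
    have := norm_sub_norm_le z₀ z
    rw [norm_sub_rev, hz₀] at this
    exact this
  have hball : ∀ ζ ∈ Metric.closedBall z ((1 - ‖z‖) / 2),
      ‖ζ‖ < 1 ∧ ‖G ζ - L‖ < ε / (4 * C) := by
    intro ζ hζ
    rw [mem_closedBall_iff_norm] at hζ
    have h₁ : ‖ζ‖ ≤ ‖z‖ + (1 - ‖z‖) / 2 := by
      have := norm_sub_norm_le ζ z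
      linarith
    have h₂ : ‖ζ - z₀‖ ≤ ‖z - z₀‖ + (1 - ‖z‖) / 2 := by
      have := norm_sub_le_norm_sub_add_norm_sub ζ z z₀
      linarith
    refine ⟨by linarith, ?_⟩
    rw [← dist_eq_norm]
    refine hδG ⟨by linarith, ?_⟩ (by rw [dist_eq_norm]; linarith)
    nlinarith
  have hderiv : ‖deriv (fun ζ => G ζ - L) z‖ ≤ ε / (4 * C) / ((1 - ‖z‖) / 2) := by
    refine Complex.norm_deriv_le_of_forall_mem_sphere_norm_le (by positivity) ?_ fun ζ hζ =>
      (hball ζ (Metric.sphere_subset_closedBall hζ)).2.le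
    refine DifferentiableOn.diffContOnCl_ball (U := Metric.ball 0 1) (hG.sub_const L) fun ζ hζ => ?_
    simpa using (hball ζ hζ).1
  rw [deriv_sub_const] at hderiv
  rw [dist_zero_right, norm_mul]
  calc ‖z - z₀‖ * ‖deriv G z‖
      ≤ (C * (1 - ‖z‖)) * (ε / (4 * C) / ((1 - ‖z‖) / 2)) := by gcongr
    _ = ε / 2 := by field_simp; norm_num
    _ < ε := by linarith

theorem analyticAt_iteratedDeriv {F : ℂ → ℂ} {z : ℂ} (hF : AnalyticAt ℂ F z) (n : ℕ) :
    AnalyticAt ℂ (iteratedDeriv n F) z := by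
  induction n with
  | zero => rwa [iteratedDeriv_zero]
  | succ n ih =>
    rw [iteratedDeriv_succ]
    exact ih.deriv

/-- Leibniz's rule; only two terms survive because the factor `ζ - z₀` is affine. -/
theorem iteratedDeriv_succ_sub_mul {F : ℂ → ℂ} {z : ℂ} (hF : AnalyticAt ℂ F z) (z₀ : ℂ) (n : ℕ) :
    iteratedDeriv (n + 1) (fun ζ => (ζ - z₀) * F ζ) z =
      (z - z₀) * iteratedDeriv (n + 1) F z + (n + 1) * iteratedDeriv n F z := by
  induction n generalizing z with
  | zero =>
    have h := (((hasDerivAt_id z).sub_const z₀).mul hF.differentiableAt.hasDerivAt).deriv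
    simp only [zero_add, iteratedDeriv_one, iteratedDeriv_zero, Nat.cast_zero, one_mul]
    refine Eq.trans h ?_
    simp [add_comm]
  | succ n ih =>
    rw [iteratedDeriv_succ]
    have hev : iteratedDeriv (n + 1) (fun ζ => (ζ - z₀) * F ζ) =ᶠ[𝓝 z]
        fun ζ => (ζ - z₀) * iteratedDeriv (n + 1) F ζ + (n + 1) * iteratedDeriv n F ζ := by
      filter_upwards [hF.eventually_analyticAt] with ζ hζ using ih hζ
    have hd : ∀ k, HasDerivAt (iteratedDeriv k F) (iteratedDeriv (k + 1) F z) z := fun k => by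
      rw [iteratedDeriv_succ]
      exact (analyticAt_iteratedDeriv hF k).differentiableAt.hasDerivAt
    have h := ((((hasDerivAt_id z).sub_const z₀).mul (hd (n + 1))).add
      ((hd n).const_mul ((n : ℂ) + 1))).deriv
    rw [hev.deriv_eq]
    refine Eq.trans h ?_
    push_cast
    simp only [id]
    ring

theorem proposition2 (z₀ : ℂ) (hz₀ : ‖z₀‖ = 1)
    (b : Lp ℂ ∞ circleMeasure) (hb : IsNonextreme b) (n : ℕ)
    (h : ∀ f ∈ deBrangesRovnyak b, ∀ k ≤ n,
      HasNontangentialLimit (iteratedDeriv k (diskFun f)) z₀) :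
    HasNontangentialLimit (iteratedDeriv (n + 1) (diskFun b)) z₀ := by
  -- Points on the radius to `z₀`, which lies in the narrowest Stolz domain, `C = 1`.
  obtain ⟨w, hw, hwz, hwS⟩ : ∃ w : ℕ → ℂ, (∀ m, ‖w m‖ < 1) ∧ Tendsto w atTop (𝓝 z₀) ∧
      ∀ m, w m ∈ stolzDomain 1 z₀ := by
    have hr : ∀ m : ℕ, (0 : ℝ) < 1 / ((m : ℝ) + 1) ∧ 1 / ((m : ℝ) + 1) ≤ 1 := fun m =>
      ⟨by positivity, by rw [div_le_one (by positivity)]; simp⟩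
    have hn : ∀ m : ℕ, ‖((1 - 1 / ((m : ℝ) + 1) : ℝ) : ℂ) * z₀‖ = 1 - 1 / ((m : ℝ) + 1) := by
      intro m
      rw [norm_mul, hz₀, mul_one, Complex.norm_real, Real.norm_of_nonneg (by linarith [(hr m).2])]
    refine ⟨fun m => ((1 - 1 / ((m : ℝ) + 1) : ℝ) : ℂ) * z₀, fun m => ?_, ?_, fun m => ⟨?_, ?_⟩⟩
    · rw [hn]; linarith [(hr m).1]
    · have h₁ := (tendsto_one_div_add_atTop_nhds_zero_nat (𝕜 := ℝ)).const_sub 1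
      have h₂ := ((Complex.continuous_ofReal.tendsto _).comp h₁).mul_const z₀
      simpa using h₂
    · rw [hn]; linarith [(hr m).1]
    · have h₁ : ((1 - 1 / ((m : ℝ) + 1) : ℝ) : ℂ) * z₀ - z₀ = ((-(1 / ((m : ℝ) + 1)) : ℝ) : ℂ) * z₀ := by
        push_cast; ring
      rw [hn, h₁, norm_mul, hz₀, Complex.norm_real, norm_neg, Real.norm_of_nonneg (hr m).1.le]
      linarith
  obtain ⟨f, hf, lam, hlam, hfb⟩ := exists_boundary_kernel hb.1 hz₀ hw hwz fun f hf => by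
    obtain ⟨L, hL⟩ := h f hf 0 (Nat.zero_le _)
    refine ⟨L, ?_⟩
    have h₁ := (hL 1 le_rfl).comp
      (tendsto_nhdsWithin_iff.mpr ⟨hwz, Eventually.of_forall hwS⟩)
    rwa [iteratedDeriv_zero] at h₁
  have hF : ∀ z ∈ Metric.ball (0 : ℂ) 1, AnalyticAt ℂ (diskFun f) z := fun z hz =>
    (differentiableOn_diskFun_H2 f).analyticAt (Metric.isOpen_ball.mem_nhds hz)
  -- The kernel formula solved for `b`, using `conj lam = 1 / lam` and `conj z₀ = 1 / z₀`.
  have hb_eq : ∀ z ∈ Metric.ball (0 : ℂ) 1, diskFun b z =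
      lam + (lam * starRingEnd ℂ z₀) * ((z - z₀) * diskFun f z) := by
    intro z hz
    rw [mem_ball_zero_iff] at hz
    have h₁ : lam * starRingEnd ℂ lam = 1 := by
      rw [Complex.mul_conj, Complex.normSq_eq_norm_sq, hlam]; norm_num
    have h₂ : z₀ * starRingEnd ℂ z₀ = 1 := by
      rw [Complex.mul_conj, Complex.normSq_eq_norm_sq, hz₀]; norm_num
    have h₃ := hfb z hz
    rw [eq_div_iff (one_sub_mul_conj_ne_zero hz hz₀)] at h₃
    linear_combination (-diskFun b z) * h₁ + lam * h₃ + lam * diskFun f z * h₂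
  obtain ⟨L, hL⟩ := h f hf n le_rfl
  refine ⟨lam * starRingEnd ℂ z₀ * ((n + 1) * L), fun C hC => ?_⟩
  have hG : DifferentiableOn ℂ (iteratedDeriv n (diskFun f)) (Metric.ball 0 1) := fun z hz =>
    (analyticAt_iteratedDeriv (hF z hz) n).differentiableAt.differentiableWithinAt
  have hlim := ((tendsto_sub_mul_deriv_stolzDomain hG hz₀ hL hC).add
    ((hL C hC).const_mul ((n : ℂ) + 1))).const_mul (lam * starRingEnd ℂ z₀)
  rw [zero_add] at hlim
  refine hlim.congr' ?_
  filter_upwards [self_mem_nhdsWithin] with z hz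
  have hz1 : z ∈ Metric.ball (0 : ℂ) 1 := mem_ball_zero_iff.mpr hz.1
  have hev : diskFun b =ᶠ[𝓝 z] fun ζ =>
      lam + (lam * starRingEnd ℂ z₀) * ((ζ - z₀) * diskFun f ζ) := by
    filter_upwards [Metric.isOpen_ball.mem_nhds hz1] with ζ hζ using hb_eq ζ hζ
  rw [hev.iteratedDeriv_eq, iteratedDeriv_const_add (Nat.succ_pos n),
    iteratedDeriv_const_mul_field, iteratedDeriv_succ_sub_mul (hF z hz1), iteratedDeriv_succ]
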